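/- Let $\Omega$ be a nonempty set (states), $\mathbb K$ a set of maps $z:[0,\infty)\to\Omega$ (processes), and $g:\Omega\to[0,1]$ a function such that $t\mapsto g(z(t))$ is Lebesgue measurable for every $z\in\mathbb K$. For each $\omega\in\Omega$ let $\mathcal L(\omega)$ and $\mathcal M(\omega)$ be nonempty sets, and to each $(l,m)\in\mathcal L(\omega)\times\mathcal M(\omega)$ let a process $\zeta[\omega,l,m]\in\mathbb K$ be assigned. For a bounded payoff $c:\mathbb K\to\mathbb R$ define the lower value $$V[c](\omega)=\sup_{l\in\mathcal L(\omega)}\ \inf_{m\in\mathcal M(\omega)}c(\zeta[\omega,l,m]),\qquad \omega\in\Omega.$$ Let $\mathfrak D$ be the set of probability densities $\varrho:[0,\infty)\to[0,\infty)$, and for $\varrho\in\mathfrak D$ put $\mathcal V[\varrho]=V[c_\varrho]$ with $c_\varrho(z)=\int_0^\infty\varrho(t)g(z(t))\,dt$. Assume that for all $T>0$ and all $\varrho\in\mathfrak D$ the value $V$ of the payoff $$z\mapsto\int_0^T\varrho(t)g(z(t))\,dt+\sup_{l\in\mathcal L(z(T))}\ \inf_{m\in\mathcal M(z(T))}\int_0^\infty\varrho(t+T)\,g\big(\zeta[z(T),l,m](t)\big)\,dt$$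 equals $\mathcal V[\varrho]$ on $\Omega$. For $\lambda,T>0$ let $\varpi_T=\frac1T 1_{[0,T]}$, $\pi_\lambda(t)=\lambda e^{-\lambda t}$, $\varrho^\lambda_{\rm scale}(t)=\lambda\varrho(\lambda t)$ and $\varrho^T_{\rm shift}(t)=\varrho(t+T)/\int_T^\infty\varrho(s)\,ds$ (when the denominator is positive). A density is a power density if it has the form $\varrho(t)=(\alpha+\beta t)^{-\gamma}$, $t\ge0$, for some $\alpha,\beta,\gamma>0$. A function is piecewise continuous on $(0,\infty)$ if it has finite one-sided limits at every point of $(0,\infty)$ and finitely many discontinuities on every compact interval $[a,b]\subset(0,\infty)$. Then for every function $U_*:\Omega\to[0,1]$ the following conditions are equivalent: (c) for every density $\mu\in\mathfrak D$ that is piecewise continuous on $(0,\infty)$, $\mathcal V[\mu^\lambda_{\rm scale}]\to U_*$ uniformly on $\Omega$ as $\lambda\to+0$; (u) $\mathcal V[\varpi_T]\to U_*$ uniformly on $\Omega$ as $T\to+\infty$; (e) $\mathcal V[\pi_\lambda]\to U_*$ uniformly on $\Omega$ as $\lambda\to+0$; (p) for some power density $\varrho\in\mathfrak D$, $\mathcal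 V[\varrho^T_{\rm shift}]\to U_*$ uniformly on $\Omega$ as $T\to+\infty$; (q) for every power density $\varrho\in\mathfrak D$, $\mathcal V[\varrho^T_{\rm shift}]\to U_*$ uniformly on $\Omega$ as $T\to+\infty$. In particular, if at least one of the limits $\lim_{T\to+\infty}\mathcal V[\varpi_T]$, $\lim_{\lambda\to+0}\mathcal V[\pi_\lambda]$, $\lim_{T\to+\infty}\mathcal V[\varrho^T_{\rm shift}]$ (the last for some power density $\varrho\in\mathfrak D$) exists uniformly on $\Omega$, then these limits and $\lim_{\lambda\to+0}\mathcal V[\mu^\lambda_{\rm scale}]$ exist uniformly on $\Omega$ for all power densities $\varrho\in\mathfrak D$ and all densities $\mu\in\mathfrak D$ piecewise continuous on $(0,\infty)$, and they all coincide. -/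

import Mathlib

open Set Filter Topology MeasureTheory
open scoped NNReal

noncomputable section

/-- A probability density on `[0, ∞)`, given by everywhere-defined nonnegative values there.
Only the restriction of `ρ` to `[0, ∞)` is ever used; its values at negative numbers are irrelevant. -/
def IsDensity (ρ : ℝ → ℝ) : Prop :=
  (∀ t, 0 ≤ t → 0 ≤ ρ t) ∧ IntegrableOn ρ (Ioi 0) ∧ ∫ t in Ioi 0, ρ t = 1

/-- The normalized shift `t ↦ ρ (t + T) / ∫_T^∞ ρ`. -/
def shiftDensity (ρ : ℝ → ℝ) (T : ℝ) : ℝ → ℝ :=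
  fun t => ρ (t + T) / ∫ s in Ioi T, ρ s

/-- The rescaling `t ↦ lam * ρ (lam * t)`. -/
def scaleDensity (ρ : ℝ → ℝ) (lam : ℝ) : ℝ → ℝ :=
  fun t => lam * ρ (lam * t)

/-- The density of the uniform distribution on `[0, T]`. -/
def uniformDensity (T : ℝ) : ℝ → ℝ :=
  (Icc 0 T).indicator fun _ => 1 / T

/-- The density of the exponential distribution with rate `lam` (on `[0, ∞)`). -/
def expDensity (lam : ℝ) : ℝ → ℝ :=
  fun t => lam * Real.exp (-(lam * t))

/-- A power density: a density of the form `(α + β t) ^ (-γ)` with `α, β, γ > 0`. -/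
def IsPowerDensity (ρ : ℝ → ℝ) : Prop :=
  IsDensity ρ ∧ ∃ α β γ : ℝ, 0 < α ∧ 0 < β ∧ 0 < γ ∧ ∀ t, 0 ≤ t → ρ t = 1 / (α + β * t) ^ γ

/-- Piecewise continuity on `(0, ∞)`: finite one-sided limits at every point, and only finitely
many discontinuities on every compact subinterval `[a, b]` of `(0, ∞)`. -/
def PiecewiseContinuousOnPos (f : ℝ → ℝ) : Prop :=
  (∀ t, 0 < t → (∃ y, Tendsto f (𝓝[<] t) (𝓝 y)) ∧ ∃ y, Tendsto f (𝓝[>] t) (𝓝 y)) ∧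
    ∀ a b, 0 < a → {t ∈ Icc a b | ¬ ContinuousAt f t}.Finite

/-- The payoff `∫_0^∞ ρ(t) g(z(t)) dt` of a process `z : [0, ∞) → Ω`. -/
def averagePayoff {Ω : Type*} (g : Ω → ℝ) (ρ : ℝ → ℝ) (z : ℝ≥0 → Ω) : ℝ :=
  ∫ t in Ioi (0 : ℝ), ρ t * g (z t.toNNReal)

/-- The lower value `ω ↦ sup_{l ∈ L ω} inf_{m ∈ M ω} c (ζ[ω, l, m])` of the game in normal form
with payoff `c`. -/
def lowerValue {Ω : Type*} {K : Set (ℝ≥0 → Ω)} {L M : Ω → Type*}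
    (ζ : ∀ ω, L ω → M ω → K) (c : K → ℝ) (ω : Ω) : ℝ :=
  ⨆ l : L ω, ⨅ m : M ω, c (ζ ω l m)

/-- The lower value for the payoff averaged with the density `ρ`. -/
def densityValue {Ω : Type*} {K : Set (ℝ≥0 → Ω)} {L M : Ω → Type*} (g : Ω → ℝ)
    (ζ : ∀ ω, L ω → M ω → K) (ρ : ℝ → ℝ) : Ω → ℝ :=
  lowerValue ζ fun z => averagePayoff g ρ z

/-- The payoff
`z ↦ ∫_0^T ρ(t) g(z(t)) dt + sup_{l ∈ L(z(T))} inf_{m ∈ M(z(T))} ∫_0^∞ ρ(t + T) g(ζ[z(T), l, m](t)) dt`.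
-/
def dynamicPayoff {Ω : Type*} {K : Set (ℝ≥0 → Ω)} {L M : Ω → Type*} (g : Ω → ℝ)
    (ζ : ∀ ω, L ω → M ω → K) (ρ : ℝ → ℝ) (T : ℝ≥0) (z : K) : ℝ :=
  (∫ t in (0 : ℝ)..T, ρ t * g (z.1 t.toNNReal)) +
    ⨆ l : L (z.1 T), ⨅ m : M (z.1 T),
      ∫ t in Ioi (0 : ℝ), ρ (t + T) * g ((ζ (z.1 T) l m).1 t.toNNReal)

end

/-! All the limits are governed by one condition on `U` that mentions no density. Stop the game at
time `θ / lam`, pay at rate `lam` until then and `(1 - θ) U` at the end: the value must return `U`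
up to `o(θ)`, uniformly in the state, once `lam` is small (`AsymptoticallyInvariant`).

Necessity: the uniform, exponential and power families are rescalings of densities equal to `1` at
`0+` whose shifts by `h` are multiples of their own rescalings. Convergence for such a density
therefore also gives the limits for its shifts, and dynamic programming at time `θ / lam` yields
invariance (`asymptoticallyInvariant_of_tendsto_shift`).

Sufficiency: for a continuous positive weight, discard a tail of small mass and cut the rest into
short steps on which the weight is nearly constant. By dynamic programming each step is a multiple
of a stopped game, so backward induction from the tail adds an error that is small compared with the
step (`eventually_abs_densityValue_sub_le_of_shift`). Values are 1-Lipschitz in the `L¹` norm of the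
weight and rescaling preserves that norm, so density of such weights in `L¹` gives every density. -/

/-! ### Values of games as functions of the payoff and of the weight -/

section Games

variable {Ω : Type*} {K : Set (ℝ≥0 → Ω)} {L M : Ω → Type*}

/-- The value is monotone up to a uniform error in the payoff. -/
theorem lowerValue_le_add [∀ ω, Nonempty (L ω)] [∀ ω, Nonempty (M ω)] (ζ : ∀ ω, L ω → M ω → K)
    {c c' : K → ℝ} {B B' η : ℝ} (hc : ∀ z, |c z| ≤ B) (hc' : ∀ z, |c' z| ≤ B')
    (h : ∀ z, c z ≤ c' z + η) (ω : Ω) : lowerValue ζ c ω ≤ lowerValue ζ c' ω + η := by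
  have hbdd : BddAbove (range fun l : L ω => ⨅ m : M ω, c' (ζ ω l m)) := by
    refine ⟨B', ?_⟩
    rintro _ ⟨l, rfl⟩
    obtain ⟨m⟩ := (inferInstance : Nonempty (M ω))
    refine (ciInf_le ⟨-B', ?_⟩ m).trans (abs_le.1 (hc' _)).2
    rintro _ ⟨m, rfl⟩
    exact (abs_le.1 (hc' _)).1
  refine ciSup_le fun l => ?_
  have h1 : (⨅ m : M ω, c (ζ ω l m)) - η ≤ ⨅ m : M ω, c' (ζ ω l m) := by
    refine le_ciInf fun m => ?_
    have h2 : (⨅ m : M ω, c (ζ ω l m)) ≤ c (ζ ω l m) := by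
      refine ciInf_le ⟨-B, ?_⟩ m
      rintro _ ⟨m, rfl⟩
      exact (abs_le.1 (hc _)).1
    linarith [h (ζ ω l m)]
  have h3 := le_ciSup hbdd l
  simp only [lowerValue]
  linarith

/-- The value is nonexpansive in the payoff. -/
theorem abs_lowerValue_sub_le [∀ ω, Nonempty (L ω)] [∀ ω, Nonempty (M ω)]
    (ζ : ∀ ω, L ω → M ω → K) {c c' : K → ℝ} {B η : ℝ} (hc : ∀ z, |c z| ≤ B)
    (h : ∀ z, |c z - c' z| ≤ η) (ω : Ω) : |lowerValue ζ c ω - lowerValue ζ c' ω| ≤ η := by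
  have hc' : ∀ z, |c' z| ≤ B + η := fun z => by
    have h1 := abs_le.1 (hc z)
    have h2 := abs_le.1 (h z)
    exact abs_le.2 ⟨by linarith, by linarith⟩
  have h1 := lowerValue_le_add ζ hc hc' (η := η) (fun z => by linarith [(abs_le.1 (h z)).2]) ω
  have h2 := lowerValue_le_add ζ hc' hc (η := η) (fun z => by linarith [(abs_le.1 (h z)).1]) ω
  exact abs_le.2 ⟨by linarith, by linarith⟩

/-- No boundedness is needed: multiplication by `a ≥ 0` respects the default value `0` of unbounded
real suprema and infima. -/
theorem lowerValue_const_mul (ζ : ∀ ω, L ω → M ω → K) (c : K → ℝ) {a : ℝ} (ha : 0 ≤ a) (ω : Ω) :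
    lowerValue ζ (fun z => a * c z) ω = a * lowerValue ζ c ω := by
  simp only [lowerValue, Real.mul_iSup_of_nonneg ha, Real.mul_iInf_of_nonneg ha]

theorem lowerValue_const [∀ ω, Nonempty (L ω)] [∀ ω, Nonempty (M ω)]
    (ζ : ∀ ω, L ω → M ω → K) (a : ℝ) (ω : Ω) : lowerValue ζ (fun _ => a) ω = a := by
  simp [lowerValue]

variable {g : Ω → ℝ}

theorem IntegrableOn.mul_payoff (hg : ∀ ω, g ω ∈ Icc (0 : ℝ) 1) {z : ℝ≥0 → Ω}
    (hz : AEMeasurable (fun t : ℝ => g (z t.toNNReal)) (volume.restrict (Ioi 0)))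
    {s : Set ℝ} (hs : s ⊆ Ioi 0) {ρ : ℝ → ℝ} (hρ : IntegrableOn ρ s) :
    IntegrableOn (fun t => ρ t * g (z t.toNNReal)) s := by
  refine Integrable.mono hρ
    (hρ.1.mul (hz.mono_measure (Measure.restrict_mono_set _ hs)).aestronglyMeasurable) ?_
  refine Eventually.of_forall fun t => ?_
  rw [norm_mul, Real.norm_of_nonneg (hg _).1]
  exact mul_le_of_le_one_right (norm_nonneg _) (hg _).2

/-- Since `0 ≤ g ≤ 1`, the bound does not depend on the process, hence it survives the supremum and
infimum. -/
theorem abs_setIntegral_mul_payoff_sub_le (hg : ∀ ω, g ω ∈ Icc (0 : ℝ) 1) {z : ℝ≥0 → Ω}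
    (hz : AEMeasurable (fun t : ℝ => g (z t.toNNReal)) (volume.restrict (Ioi 0)))
    {s : Set ℝ} (hs : s ⊆ Ioi 0) {ρ σ : ℝ → ℝ} (hρ : IntegrableOn ρ s) (hσ : IntegrableOn σ s) :
    |(∫ t in s, ρ t * g (z t.toNNReal)) - ∫ t in s, σ t * g (z t.toNNReal)| ≤
      ∫ t in s, |ρ t - σ t| := by
  rw [← integral_sub (IntegrableOn.mul_payoff hg hz hs hρ) (IntegrableOn.mul_payoff hg hz hs hσ)]
  refine (abs_integral_le_integral_abs).trans ?_
  refine integral_mono_of_nonneg (Eventually.of_forall fun t => abs_nonneg _)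
    (Integrable.abs (hρ.sub hσ)) (Eventually.of_forall fun t => ?_)
  simp only
  rw [← sub_mul, abs_mul, abs_of_nonneg (hg _).1]
  exact mul_le_of_le_one_right (abs_nonneg _) (hg _).2

theorem abs_setIntegral_mul_payoff_le (hg : ∀ ω, g ω ∈ Icc (0 : ℝ) 1) {z : ℝ≥0 → Ω}
    (hz : AEMeasurable (fun t : ℝ => g (z t.toNNReal)) (volume.restrict (Ioi 0)))
    {s : Set ℝ} (hs : s ⊆ Ioi 0) {ρ : ℝ → ℝ} (hρ : IntegrableOn ρ s) :
    |∫ t in s, ρ t * g (z t.toNNReal)| ≤ ∫ t in s, |ρ t| := by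
  simpa using abs_setIntegral_mul_payoff_sub_le hg hz hs hρ (σ := fun _ => 0)
    (by simp [IntegrableOn])

theorem densityValue_congr (g : Ω → ℝ) (ζ : ∀ ω, L ω → M ω → K) {ρ σ : ℝ → ℝ}
    (h : ∀ t, 0 < t → ρ t = σ t) : densityValue g ζ ρ = densityValue g ζ σ := by
  have h' : ∀ z : ℝ≥0 → Ω, averagePayoff g ρ z = averagePayoff g σ z := fun z =>
    setIntegral_congr_fun measurableSet_Ioi fun t ht => by simp only [h t ht]
  simp only [densityValue, h']

theorem densityValue_const_mul (g : Ω → ℝ) (ζ : ∀ ω, L ω → M ω → K) (ρ : ℝ → ℝ) {a : ℝ}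
    (ha : 0 ≤ a) (ω : Ω) :
    densityValue g ζ (fun t => a * ρ t) ω = a * densityValue g ζ ρ ω := by
  rw [densityValue, densityValue, ← lowerValue_const_mul ζ _ ha]
  simp only [averagePayoff, mul_assoc, integral_const_mul]

/-- The value of a nonnegative payoff is nonnegative. -/
theorem densityValue_nonneg (hg : ∀ ω, g ω ∈ Icc (0 : ℝ) 1) (ζ : ∀ ω, L ω → M ω → K)
    {ρ : ℝ → ℝ} (hρ : ∀ t, 0 ≤ t → 0 ≤ ρ t) (ω : Ω) : 0 ≤ densityValue g ζ ρ ω :=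
  Real.iSup_nonneg fun _ => Real.iInf_nonneg fun _ =>
    setIntegral_nonneg measurableSet_Ioi fun t ht => mul_nonneg (hρ t (le_of_lt ht)) (hg _).1

/-- Dynamic programming for densities extends to integrable weights of positive mass. -/
theorem densityValue_eq_lowerValue_add (ζ : ∀ ω, L ω → M ω → K)
    (hdp : ∀ T : ℝ≥0, 0 < T → ∀ ρ : ℝ → ℝ, IsDensity ρ →
      ∀ ω, lowerValue ζ (dynamicPayoff g ζ ρ T) ω = densityValue g ζ ρ ω)
    {ρ : ℝ → ℝ} (h0 : ∀ t, 0 ≤ t → 0 ≤ ρ t) (hi : IntegrableOn ρ (Ioi 0))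
    (hm : 0 < ∫ t in Ioi 0, ρ t) {T : ℝ} (hT : 0 < T) (ω : Ω) :
    densityValue g ζ ρ ω = lowerValue ζ (fun z => (∫ t in Ioc 0 T, ρ t * g (z.1 t.toNNReal)) +
      densityValue g ζ (fun t => ρ (t + T)) (z.1 T.toNNReal)) ω := by
  -- Dynamic programming is assumed for densities only; normalize by the mass `m`, then cancel `m⁻¹`
  -- by positive homogeneity of both the inner and the outer value.
  set m := ∫ t in Ioi 0, ρ t with hm_def
  have hm' : 0 ≤ m⁻¹ := (inv_pos.2 hm).le
  have hd : IsDensity (fun t => m⁻¹ * ρ t) := by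
    refine ⟨fun t ht => mul_nonneg hm' (h0 t ht), hi.const_mul _, ?_⟩
    rw [integral_const_mul, ← hm_def, inv_mul_cancel₀ hm.ne']
  have h := hdp T.toNNReal (Real.toNNReal_pos.2 hT) _ hd ω
  rw [densityValue_const_mul g ζ ρ hm'] at h
  have h2 : dynamicPayoff g ζ (fun t => m⁻¹ * ρ t) T.toNNReal = fun z =>
      m⁻¹ * ((∫ t in Ioc 0 T, ρ t * g (z.1 t.toNNReal)) +
        densityValue g ζ (fun t => ρ (t + T)) (z.1 T.toNNReal)) := by
    funext z
    have h3 := densityValue_const_mul g ζ (fun t => ρ (t + T)) hm' (z.1 T.toNNReal)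
    rw [mul_add, ← h3, ← integral_const_mul]
    simp only [dynamicPayoff, Real.coe_toNNReal _ hT.le, intervalIntegral.integral_of_le hT.le,
      mul_assoc]
    simp only [densityValue, lowerValue, averagePayoff, mul_assoc]
  rw [h2, lowerValue_const_mul ζ _ hm'] at h
  exact (mul_left_cancel₀ (inv_pos.2 hm).ne' h).symm

variable [∀ ω, Nonempty (L ω)] [∀ ω, Nonempty (M ω)]

theorem abs_densityValue_sub_le (hg : ∀ ω, g ω ∈ Icc (0 : ℝ) 1)
    (hmeas : ∀ z ∈ K, AEMeasurable (fun t : ℝ => g (z t.toNNReal)) (volume.restrict (Ioi 0)))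
    (ζ : ∀ ω, L ω → M ω → K) {ρ σ : ℝ → ℝ} (hρ : IntegrableOn ρ (Ioi 0))
    (hσ : IntegrableOn σ (Ioi 0)) (ω : Ω) :
    |densityValue g ζ ρ ω - densityValue g ζ σ ω| ≤ ∫ t in Ioi 0, |ρ t - σ t| :=
  abs_lowerValue_sub_le ζ
    (fun z => abs_setIntegral_mul_payoff_le hg (hmeas z z.2) Subset.rfl hρ)
    (fun z => abs_setIntegral_mul_payoff_sub_le hg (hmeas z z.2) Subset.rfl hρ hσ) ω

theorem abs_densityValue_le (hg : ∀ ω, g ω ∈ Icc (0 : ℝ) 1)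
    (hmeas : ∀ z ∈ K, AEMeasurable (fun t : ℝ => g (z t.toNNReal)) (volume.restrict (Ioi 0)))
    (ζ : ∀ ω, L ω → M ω → K) {ρ : ℝ → ℝ} (hρ : IntegrableOn ρ (Ioi 0)) (ω : Ω) :
    |densityValue g ζ ρ ω| ≤ ∫ t in Ioi 0, |ρ t| := by
  have h := abs_lowerValue_sub_le ζ (c' := fun _ => 0)
    (fun z => abs_setIntegral_mul_payoff_le hg (hmeas z z.2) Subset.rfl hρ)
    (fun z => by simpa using abs_setIntegral_mul_payoff_le hg (hmeas z z.2) Subset.rfl hρ) ω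
  rw [lowerValue_const, sub_zero] at h
  exact h

end Games

/-! ### Rescaling, shifting and tails of weights -/

section Weights

/-- Makes the error of an `L¹` approximation uniform in `lam`. -/
theorem integral_scaleDensity_abs_sub (ρ σ : ℝ → ℝ) {lam : ℝ} (hl : 0 < lam) :
    ∫ t in Ioi 0, |scaleDensity ρ lam t - scaleDensity σ lam t| = ∫ t in Ioi 0, |ρ t - σ t| := by
  simp only [scaleDensity, ← mul_sub, abs_mul, abs_of_pos hl, integral_const_mul]
  have h := integral_comp_mul_left_Ioi (fun t => |ρ t - σ t|) 0 hl
  simp only [mul_zero, smul_eq_mul] at h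
  rw [h, mul_inv_cancel_left₀ hl.ne']

theorem integral_scaleDensity (ρ : ℝ → ℝ) {lam : ℝ} (hl : 0 < lam) :
    ∫ t in Ioi 0, scaleDensity ρ lam t = ∫ t in Ioi 0, ρ t := by
  simp only [scaleDensity, integral_const_mul]
  rw [integral_comp_mul_left_Ioi ρ 0 hl, mul_zero, smul_eq_mul, mul_inv_cancel_left₀ hl.ne']

theorem IntegrableOn.scaleDensity {ρ : ℝ → ℝ} (hρ : IntegrableOn ρ (Ioi 0)) {lam : ℝ}
    (hl : 0 < lam) : IntegrableOn (scaleDensity ρ lam) (Ioi 0) := by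
  refine Integrable.const_mul ?_ lam
  exact (integrableOn_Ioi_comp_mul_left_iff ρ 0 hl).2 (by simpa using hρ)

theorem integral_comp_add_right_Ioi_zero (ρ : ℝ → ℝ) (h : ℝ) :
    ∫ t in Ioi 0, ρ (t + h) = ∫ t in Ioi h, ρ t := by
  have := (measurePreserving_add_right volume h).setIntegral_preimage_emb
    (measurableEmbedding_addRight h) ρ (Ioi h)
  simpa using this

theorem integrableOn_comp_add_right_Ioi_zero_iff {ρ : ℝ → ℝ} {h : ℝ} :
    IntegrableOn (fun t => ρ (t + h)) (Ioi 0) ↔ IntegrableOn ρ (Ioi h) := by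
  have := (measurePreserving_add_right volume h).integrableOn_comp_preimage
    (measurableEmbedding_addRight h) (f := ρ) (s := Ioi h)
  simpa [Function.comp_def] using this

theorem IntegrableOn.comp_add_right_Ioi {ρ : ℝ → ℝ} (hρ : IntegrableOn ρ (Ioi 0)) {h : ℝ}
    (hh : 0 ≤ h) : IntegrableOn (fun t => ρ (t + h)) (Ioi 0) :=
  integrableOn_comp_add_right_Ioi_zero_iff.2 (hρ.mono_set (Ioi_subset_Ioi hh))

theorem setIntegral_Ioc_add_Ioi {ρ : ℝ → ℝ} (hρ : IntegrableOn ρ (Ioi 0)) {h : ℝ} (hh : 0 ≤ h) :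
    (∫ t in Ioc 0 h, ρ t) + ∫ t in Ioi h, ρ t = ∫ t in Ioi 0, ρ t := by
  rw [← Ioc_union_Ioi_eq_Ioi hh, setIntegral_union (Ioc_disjoint_Ioi le_rfl) measurableSet_Ioi
    (hρ.mono_set Ioc_subset_Ioi_self) (hρ.mono_set (Ioi_subset_Ioi hh))]

theorem abs_setIntegral_Ioc_sub_le {ρ : ℝ → ℝ} {h p δ : ℝ} (hρ : IntegrableOn ρ (Ioi 0))
    (hh : 0 ≤ h) (hp : ∀ t ∈ Ioc 0 h, |ρ t - p| ≤ δ) : |(∫ t in Ioc 0 h, ρ t) - p * h| ≤ δ * h := by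
  have h1 : (∫ t in Ioc 0 h, ρ t) - p * h = ∫ t in Ioc 0 h, (ρ t - p) := by
    rw [integral_sub (hρ.mono_set Ioc_subset_Ioi_self) (by simp)]
    simp [hh, mul_comm]
  rw [h1]
  have := norm_setIntegral_le_of_norm_le_const (μ := volume) (s := Ioc 0 h)
    (f := fun t => ρ t - p) (C := δ) (by simp) hp
  simpa [hh] using this

theorem tendsto_setIntegral_Ioi_atTop {ρ : ℝ → ℝ} (hρ : IntegrableOn ρ (Ioi 0)) :
    Tendsto (fun X => ∫ t in Ioi X, ρ t) atTop (𝓝 0) := by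
  have h1 := (intervalIntegral_tendsto_integral_Ioi 0 hρ tendsto_id).const_sub
    (∫ t in Ioi 0, ρ t)
  rw [sub_self] at h1
  refine h1.congr' ?_
  filter_upwards [eventually_ge_atTop 0] with X hX
  rw [← setIntegral_Ioc_add_Ioi hρ hX, id, intervalIntegral.integral_of_le hX]
  ring

theorem setIntegral_Ioi_pos {ρ : ℝ → ℝ} (hρ : IntegrableOn ρ (Ioi 0)) (h0 : ∀ t, 0 < ρ t) {X : ℝ}
    (hX : 0 ≤ X) : 0 < ∫ t in Ioi X, ρ t := by
  rw [setIntegral_pos_iff_support_of_nonneg_ae (Eventually.of_forall fun t => (h0 t).le)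
    (hρ.mono_set (Ioi_subset_Ioi hX))]
  have : Function.support ρ = univ := eq_univ_of_forall fun t => (h0 t).ne'
  simp [this]

end Weights

/-! ### One step of dynamic programming -/

section OneStep

variable {Ω : Type*} {K : Set (ℝ≥0 → Ω)} {L M : Ω → Type*}

/-- The value of the game stopped at time `θ / lam`, with running payoff at rate `lam` and
terminal payoff `(1 - θ) U`. -/
noncomputable def stoppedGameValue (g : Ω → ℝ) (ζ : ∀ ω, L ω → M ω → K) (U : Ω → ℝ) (θ lam : ℝ) :
    Ω → ℝ :=
  lowerValue ζ fun z => (∫ t in Ioc 0 (θ / lam), lam * g (z.1 t.toNNReal)) +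
    (1 - θ) * U (z.1 (θ / lam).toNNReal)

/-- `U` is asymptotically invariant, to first order in `θ`, under the operators `stoppedGameValue`. -/
def AsymptoticallyInvariant (g : Ω → ℝ) (ζ : ∀ ω, L ω → M ω → K) (U : Ω → ℝ) : Prop :=
  ∀ ε, 0 < ε → ∃ θ₀, 0 < θ₀ ∧ ∀ θ, 0 < θ → θ < θ₀ →
    ∀ᶠ lam in 𝓝[>] (0 : ℝ), ∀ ω, |stoppedGameValue g ζ U θ lam ω - U ω| ≤ ε * θ

variable {g : Ω → ℝ} [∀ ω, Nonempty (L ω)] [∀ ω, Nonempty (M ω)]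

/-- Comparison of two games stopped at the same time. -/
theorem abs_lowerValue_stopped_sub_le (hg : ∀ ω, g ω ∈ Icc (0 : ℝ) 1)
    (hmeas : ∀ z ∈ K, AEMeasurable (fun t : ℝ => g (z t.toNNReal)) (volume.restrict (Ioi 0)))
    (ζ : ∀ ω, L ω → M ω → K) {ρ : ℝ → ℝ} (hi : IntegrableOn ρ (Ioi 0)) {h p δ lam η B : ℝ}
    (hh : 0 ≤ h) (hl : 0 < lam) (hp : ∀ t ∈ Ioc 0 h, |ρ t - p| ≤ δ)
    {A A' : Ω → ℝ} (hB : ∀ ω, |A ω| ≤ B) (hA : ∀ ω, |A ω - A' ω| ≤ η) (ω : Ω) :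
    |lowerValue ζ (fun z => (∫ t in Ioc 0 (h / lam),
        scaleDensity ρ lam t * g (z.1 t.toNNReal)) + A (z.1 (h / lam).toNNReal)) ω -
      lowerValue ζ (fun z => (∫ t in Ioc 0 (h / lam), lam * p * g (z.1 t.toNNReal)) +
        A' (z.1 (h / lam).toNNReal)) ω| ≤ δ * h + η := by
  have hs : Ioc 0 (h / lam) ⊆ Ioi 0 := Ioc_subset_Ioi_self
  have hr : IntegrableOn (scaleDensity ρ lam) (Ioc 0 (h / lam)) :=
    (IntegrableOn.scaleDensity hi hl).mono_set hs
  have hc : IntegrableOn (fun _ : ℝ => lam * p) (Ioc 0 (h / lam)) :=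
    integrableOn_const (by simp)
  -- A rate error `lam * δ` over a time `h / lam`: the factors `lam` cancel.
  have hd : ∫ t in Ioc 0 (h / lam), |scaleDensity ρ lam t - lam * p| ≤ δ * h := by
    have := norm_setIntegral_le_of_norm_le_const (μ := volume) (s := Ioc 0 (h / lam))
      (f := fun t => |scaleDensity ρ lam t - lam * p|) (C := lam * δ) (by simp) (fun t ht => by
        rw [norm_abs_eq_norm, scaleDensity, ← mul_sub, norm_mul, Real.norm_of_nonneg hl.le]
        refine mul_le_mul_of_nonneg_left (hp _ ⟨mul_pos hl ht.1, ?_⟩) hl.le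
        have := (le_div_iff₀ hl).1 ht.2
        linarith)
    refine (le_abs_self _).trans (this.trans_eq ?_)
    have h2 : 0 ≤ h / lam := by positivity
    simp only [measureReal_def, Real.volume_Ioc, sub_zero, ENNReal.toReal_ofReal h2]
    field_simp
  refine abs_lowerValue_sub_le ζ (B := (∫ t in Ioc 0 (h / lam), |scaleDensity ρ lam t|) + B)
    (fun z => ?_) (fun z => ?_) ω
  · exact (abs_add_le _ _).trans
      (add_le_add (abs_setIntegral_mul_payoff_le hg (hmeas z z.2) hs hr) (hB _))
  · have h1 := abs_setIntegral_mul_payoff_sub_le hg (hmeas z z.2) hs hr hc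
    rw [add_sub_add_comm]
    exact (abs_add_le _ _).trans (add_le_add (h1.trans hd) (hA _))

/-- A weight nearly constant on `[0, h]` inherits the approximate value of its shift by `h`. -/
theorem eventually_abs_densityValue_sub_le_of_shift (hg : ∀ ω, g ω ∈ Icc (0 : ℝ) 1)
    (hmeas : ∀ z ∈ K, AEMeasurable (fun t : ℝ => g (z t.toNNReal)) (volume.restrict (Ioi 0)))
    (ζ : ∀ ω, L ω → M ω → K)
    (hdp : ∀ T : ℝ≥0, 0 < T → ∀ ρ : ℝ → ℝ, IsDensity ρ →
      ∀ ω, lowerValue ζ (dynamicPayoff g ζ ρ T) ω = densityValue g ζ ρ ω)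
    {U : Ω → ℝ} (hU : ∀ ω, U ω ∈ Icc (0 : ℝ) 1) {ε θ₀ : ℝ}
    (hstep : ∀ θ, 0 < θ → θ < θ₀ →
      ∀ᶠ lam in 𝓝[>] (0 : ℝ), ∀ ω, |stoppedGameValue g ζ U θ lam ω - U ω| ≤ ε * θ)
    {ρ : ℝ → ℝ} (h0 : ∀ t, 0 ≤ t → 0 ≤ ρ t) (hi : IntegrableOn ρ (Ioi 0)) {h p δ η : ℝ}
    (hh : 0 < h) (hp0 : 0 < p) (hp : ∀ t ∈ Ioc 0 h, |ρ t - p| ≤ δ)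
    (hR : 0 < ∫ t in Ioi h, ρ t) (hθ : p * h < θ₀ * ∫ t in Ioi h, ρ t)
    (hnear : ∀ᶠ lam in 𝓝[>] (0 : ℝ), ∀ ω,
      |densityValue g ζ (scaleDensity (fun t => ρ (t + h)) lam) ω -
        (∫ t in Ioi h, ρ t) * U ω| ≤ η) :
    ∀ᶠ lam in 𝓝[>] (0 : ℝ), ∀ ω,
      |densityValue g ζ (scaleDensity ρ lam) ω - (∫ t in Ioi 0, ρ t) * U ω| ≤
        η + (ε * p * h + 2 * δ * h) := by
  set R := ∫ t in Ioi h, ρ t with hR_def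
  have hph : 0 < p * h := mul_pos hp0 hh
  -- The mass after replacing `ρ` by `p` on `[0, h]`. The relative mass of this first stage, `p * h
  -- / m`, is the `θ` of the stopped game.
  set m := p * h + R with hm_def
  have hm : 0 < m := by positivity
  have hθ' : p * h / m < θ₀ := by
    rw [div_lt_iff₀ hm]
    have hθ₀ : 0 < θ₀ := pos_of_mul_pos_left (hph.trans hθ) hR.le
    nlinarith
  have hlim : Tendsto (fun lam : ℝ => p * lam / m) (𝓝[>] 0) (𝓝[>] 0) := by
    refine tendsto_nhdsWithin_iff.2 ⟨?_, ?_⟩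
    · refine Tendsto.mono_left ?_ nhdsWithin_le_nhds
      have : Continuous fun lam : ℝ => p * lam / m := by fun_prop
      simpa using this.tendsto 0
    · filter_upwards [self_mem_nhdsWithin] with lam hl
      exact div_pos (mul_pos hp0 hl) hm
  have hsplit := setIntegral_Ioc_add_Ioi hi hh.le
  have hmass := abs_setIntegral_Ioc_sub_le hi hh.le hp
  have hpos : 0 < ∫ t in Ioi 0, ρ t := by
    rw [← hsplit]
    refine add_pos_of_nonneg_of_pos (setIntegral_nonneg measurableSet_Ioc fun t ht => h0 t ht.1.le) hR
  filter_upwards [hnear, hlim.eventually (hstep _ (div_pos hph hm) hθ'), self_mem_nhdsWithin]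
    with lam h1 h2 hl ω
  have hl : 0 < lam := hl
  have hdpp := densityValue_eq_lowerValue_add ζ hdp (ρ := scaleDensity ρ lam)
    (fun t ht => mul_nonneg hl.le (h0 _ (mul_nonneg hl.le ht))) (IntegrableOn.scaleDensity hi hl)
    (by rwa [integral_scaleDensity ρ hl]) (div_pos hh hl) ω
  have hshift : (fun t => scaleDensity ρ lam (t + h / lam)) =
      scaleDensity (fun t => ρ (t + h)) lam := by
    funext t
    simp only [scaleDensity]
    congr 2
    field_simp
  rw [hshift] at hdpp
  have hB := abs_densityValue_le hg hmeas ζ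
    (IntegrableOn.scaleDensity (IntegrableOn.comp_add_right_Ioi hi hh.le) hl)
  have hcmp := abs_lowerValue_stopped_sub_le hg hmeas ζ hi hh.le hl hp hB h1 ω
  rw [← hdpp] at hcmp
  -- With rate `p * lam / m` the stopping time is again `h / lam`, and `m * (1 - θ) = R`; thus the
  -- frozen game is `m` times a stopped game.
  have hst : lowerValue ζ (fun z => (∫ t in Ioc 0 (h / lam), lam * p * g (z.1 t.toNNReal)) +
        R * U (z.1 (h / lam).toNNReal)) ω = m * stoppedGameValue g ζ U (p * h / m) (p * lam / m) ω := by
    have e1 : p * h / m / (p * lam / m) = h / lam := by field_simp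
    have e2 : m * (1 - p * h / m) = R := by field_simp; rw [hm_def]; ring
    rw [stoppedGameValue, ← lowerValue_const_mul ζ _ hm.le]
    simp only [e1, mul_add, ← integral_const_mul, ← mul_assoc, e2]
    have e3 : m * (p * lam / m) = lam * p := by field_simp
    simp only [e3]
  rw [hst] at hcmp
  have h3 : |m * stoppedGameValue g ζ U (p * h / m) (p * lam / m) ω - m * U ω| ≤ ε * p * h := by
    rw [← mul_sub, abs_mul, abs_of_pos hm]
    refine (mul_le_mul_of_nonneg_left (h2 ω) hm.le).trans_eq ?_
    field_simp
  -- The second `δ * h`: freezing `ρ` changes the mass as well as the payoff.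
  have h4 : |m * U ω - (∫ t in Ioi 0, ρ t) * U ω| ≤ δ * h := by
    rw [← sub_mul, abs_mul, abs_of_nonneg (hU ω).1, abs_sub_comm, ← hsplit, hm_def,
      add_sub_add_right_eq_sub]
    exact (mul_le_of_le_one_right (abs_nonneg _) (hU ω).2).trans hmass
  have h5 := abs_sub_le (densityValue g ζ (scaleDensity ρ lam) ω)
    (m * stoppedGameValue g ζ U (p * h / m) (p * lam / m) ω) ((∫ t in Ioi 0, ρ t) * U ω)
  have h6 := abs_sub_le (m * stoppedGameValue g ζ U (p * h / m) (p * lam / m) ω) (m * U ω)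
    ((∫ t in Ioi 0, ρ t) * U ω)
  linarith

/-- A density close to `1` near `0` yields asymptotic invariance as soon as the values for it and
for its small shifts converge. -/
theorem asymptoticallyInvariant_of_tendsto_shift (hg : ∀ ω, g ω ∈ Icc (0 : ℝ) 1)
    (hmeas : ∀ z ∈ K, AEMeasurable (fun t : ℝ => g (z t.toNNReal)) (volume.restrict (Ioi 0)))
    (ζ : ∀ ω, L ω → M ω → K)
    (hdp : ∀ T : ℝ≥0, 0 < T → ∀ ρ : ℝ → ℝ, IsDensity ρ →
      ∀ ω, lowerValue ζ (dynamicPayoff g ζ ρ T) ω = densityValue g ζ ρ ω)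
    {U : Ω → ℝ} (hU : ∀ ω, U ω ∈ Icc (0 : ℝ) 1) {ρ : ℝ → ℝ} (hρ : IsDensity ρ)
    (hone : Tendsto ρ (𝓝[>] 0) (𝓝 1)) {b : ℝ} (hb : 0 < b)
    (hlim : TendstoUniformly (fun lam => densityValue g ζ (scaleDensity ρ lam)) U (𝓝[>] 0))
    (hshift : ∀ h, 0 < h → h < b → TendstoUniformly
      (fun lam => densityValue g ζ (scaleDensity (fun t => ρ (t + h)) lam))
      (fun ω => (∫ t in Ioi h, ρ t) * U ω) (𝓝[>] 0)) :
    AsymptoticallyInvariant g ζ U := by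
  intro ε hε
  obtain ⟨θ₁, hθ₁, hclose⟩ : ∃ θ₁ > 0, ∀ t, 0 < t → t < θ₁ → |ρ t - 1| ≤ ε / 4 := by
    have := hone.eventually (Metric.closedBall_mem_nhds (1 : ℝ) (show 0 < ε / 4 by positivity))
    obtain ⟨θ₁, h1, h2⟩ := mem_nhdsGT_iff_exists_Ioo_subset.1 this
    exact ⟨θ₁, h1, fun t ht ht' => by simpa [Real.dist_eq] using h2 ⟨ht, ht'⟩⟩
  refine ⟨min θ₁ b, lt_min hθ₁ hb, fun θ hθ hθ' => ?_⟩
  have hclose' : ∀ t ∈ Ioc 0 θ, |ρ t - 1| ≤ ε / 4 := fun t ht =>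
    hclose t ht.1 (ht.2.trans_lt (hθ'.trans_le (min_le_left _ _)))
  have hεθ : 0 < ε * θ / 4 := by positivity
  have hmass := abs_setIntegral_Ioc_sub_le hρ.2.1 hθ.le hclose'
  have hsplit := setIntegral_Ioc_add_Ioi hρ.2.1 hθ.le
  rw [hρ.2.2] at hsplit
  filter_upwards [Metric.tendstoUniformly_iff.1 hlim _ hεθ,
    Metric.tendstoUniformly_iff.1 (hshift θ hθ (hθ'.trans_le (min_le_right _ _))) _ hεθ,
    self_mem_nhdsWithin] with lam h1 h2 hl ω
  have hl : 0 < lam := hl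
  have hdpp := densityValue_eq_lowerValue_add ζ hdp (ρ := scaleDensity ρ lam)
    (fun t ht => mul_nonneg hl.le (hρ.1 _ (mul_nonneg hl.le ht)))
    (IntegrableOn.scaleDensity hρ.2.1 hl)
    (by rw [integral_scaleDensity ρ hl, hρ.2.2]; exact one_pos) (div_pos hθ hl) ω
  have hsh : (fun t => scaleDensity ρ lam (t + θ / lam)) =
      scaleDensity (fun t => ρ (t + θ)) lam := by
    funext t
    simp only [scaleDensity]
    congr 2
    field_simp
  rw [hsh] at hdpp
  have hB := abs_densityValue_le hg hmeas ζ
    (IntegrableOn.scaleDensity (IntegrableOn.comp_add_right_Ioi hρ.2.1 hθ.le) hl)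
  -- As `ρ` is near `1` on `(0, θ]`, the tail mass is `1 - θ` up to `ε * θ / 4`. The total budget is
  -- `ε * θ / 2` here, `ε * θ / 4` for freezing the running payoff and `ε * θ / 4` for the limit of
  -- the unshifted values.
  have hA : ∀ ω, |densityValue g ζ (scaleDensity (fun t => ρ (t + θ)) lam) ω - (1 - θ) * U ω| ≤
      ε * θ / 2 := fun ω => by
    have e1 := h2 ω
    rw [Real.dist_eq, abs_sub_comm] at e1
    have e2 : |(∫ t in Ioi θ, ρ t) * U ω - (1 - θ) * U ω| ≤ ε / 4 * θ := by
      rw [← sub_mul, abs_mul, abs_of_nonneg (hU ω).1]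
      refine (mul_le_of_le_one_right (abs_nonneg _) (hU ω).2).trans ?_
      have e3 : (∫ t in Ioi θ, ρ t) - (1 - θ) = -((∫ t in Ioc 0 θ, ρ t) - 1 * θ) := by
        linarith
      rwa [e3, abs_neg]
    have e3 := abs_sub_le (densityValue g ζ (scaleDensity (fun t => ρ (t + θ)) lam) ω)
      ((∫ t in Ioi θ, ρ t) * U ω) ((1 - θ) * U ω)
    linarith
  have hcmp := abs_lowerValue_stopped_sub_le hg hmeas ζ hρ.2.1 hθ.le hl hclose' hB hA ω
  rw [← hdpp] at hcmp
  simp only [mul_one] at hcmp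
  change |_ - stoppedGameValue g ζ U θ lam ω| ≤ _ at hcmp
  have h3 := h1 ω
  rw [Real.dist_eq, abs_sub_comm] at h3
  rw [abs_sub_comm] at hcmp
  have h4 := abs_sub_le (stoppedGameValue g ζ U θ lam ω) (densityValue g ζ (scaleDensity ρ lam) ω) (U ω)
  linarith

end OneStep

/-! ### From invariance to convergence for every density -/

section Convergence

variable {Ω : Type*} {K : Set (ℝ≥0 → Ω)} {L M : Ω → Type*} {g : Ω → ℝ}
  [∀ ω, Nonempty (L ω)] [∀ ω, Nonempty (M ω)]

/-- Asymptotic invariance determines the limit values of continuous positive weights. -/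
theorem AsymptoticallyInvariant.eventually_abs_densityValue_sub_le
    (hg : ∀ ω, g ω ∈ Icc (0 : ℝ) 1)
    (hmeas : ∀ z ∈ K, AEMeasurable (fun t : ℝ => g (z t.toNNReal)) (volume.restrict (Ioi 0)))
    {ζ : ∀ ω, L ω → M ω → K}
    (hdp : ∀ T : ℝ≥0, 0 < T → ∀ ρ : ℝ → ℝ, IsDensity ρ →
      ∀ ω, lowerValue ζ (dynamicPayoff g ζ ρ T) ω = densityValue g ζ ρ ω)
    {U : Ω → ℝ} (hU : ∀ ω, U ω ∈ Icc (0 : ℝ) 1) (hinv : AsymptoticallyInvariant g ζ U)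
    {ρ : ℝ → ℝ} (hc : Continuous ρ) (h0 : ∀ t, 0 < ρ t) (hi : IntegrableOn ρ (Ioi 0))
    {η : ℝ} (hη : 0 < η) :
    ∀ᶠ lam in 𝓝[>] (0 : ℝ), ∀ ω,
      |densityValue g ζ (scaleDensity ρ lam) ω - (∫ t in Ioi 0, ρ t) * U ω| ≤ η := by
  obtain ⟨X, hX0, hX⟩ : ∃ X, 0 < X ∧ ∫ t in Ioi X, ρ t < η / 4 :=
    ((eventually_gt_atTop 0).and ((tendsto_setIntegral_Ioi_atTop hi).eventually
      (gt_mem_nhds (show 0 < η / 4 by positivity)))).exists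
  obtain ⟨P, hP⟩ : ∃ P, ∀ t ∈ Icc 0 X, ρ t ≤ P :=
    (isCompact_Icc.bddAbove_image hc.continuousOn).imp fun P hP t ht => hP (mem_image_of_mem _ ht)
  have hP0 : 0 < P := (h0 0).trans_le (hP 0 ⟨le_rfl, hX0.le⟩)
  have hR0 := setIntegral_Ioi_pos hi h0 hX0.le
  -- Since `ρ ≤ P` on `[0, X]`, a step of length `h` costs at most `η / (4 * X) * h` through
  -- invariance and, with oscillation `η / (8 * X)`, as much again through freezing. Over the length
  -- `X` this sums to `η / 2`.
  obtain ⟨θ₀, hθ₀, hstep⟩ := hinv (η / (4 * X * P)) (by positivity)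
  obtain ⟨d, hd, hunif⟩ := Metric.uniformContinuousOn_iff.1
    (isCompact_Icc.uniformContinuousOn_of_continuous (hc.continuousOn (s := Icc 0 X)))
    (η / (8 * X)) (by positivity)
  -- The mesh `X / n` must be below the modulus of continuity `d`, and each step must carry a
  -- relative mass below `θ₀`; the tail beyond `X` bounds all remaining masses from below.
  obtain ⟨n, hn⟩ := exists_nat_gt (max (X / d) (X * P / (θ₀ * ∫ t in Ioi X, ρ t)))
  have hn0 : (0 : ℝ) < n := (le_max_of_le_left (by positivity)).trans_lt hn
  set h := X / n with hh_def
  have hh : 0 < h := by positivity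
  have hnh : n * h = X := by rw [hh_def]; field_simp
  have hhd : h < d := by
    have := (le_max_left _ _).trans_lt hn
    rw [div_lt_iff₀ hd] at this
    rw [hh_def, div_lt_iff₀ hn0]
    linarith
  have hhP : P * h < θ₀ * ∫ t in Ioi X, ρ t := by
    have := (le_max_right _ _).trans_lt hn
    rw [div_lt_iff₀ (by positivity)] at this
    rw [hh_def, mul_div_assoc', div_lt_iff₀ hn0]
    linarith
  -- Backward induction from `X` to `0`. At `k = 0` both terms are at most the tail mass, below `η /
  -- 4`, so no information on the value is needed.
  have key : ∀ k : ℕ, k ≤ n → ∀ᶠ lam in 𝓝[>] (0 : ℝ), ∀ ω,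
      |densityValue g ζ (scaleDensity (fun t => ρ (t + (X - k * h))) lam) ω -
        (∫ t in Ioi (X - k * h), ρ t) * U ω| ≤ η / 2 + k * (η / (2 * X) * h) := by
    intro k
    induction k with
    | zero =>
      intro _
      filter_upwards [self_mem_nhdsWithin] with lam hl ω
      have hl : 0 < lam := hl
      simp only [Nat.cast_zero, zero_mul, sub_zero, add_zero]
      have h1 := abs_densityValue_le hg hmeas ζ
        (IntegrableOn.scaleDensity (IntegrableOn.comp_add_right_Ioi hi hX0.le) hl) ω
      have h2 : ∫ t in Ioi 0, |scaleDensity (fun t => ρ (t + X)) lam t| = ∫ t in Ioi X, ρ t := by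
        rw [← integral_comp_add_right_Ioi_zero ρ X,
          ← integral_scaleDensity (fun t => ρ (t + X)) hl]
        exact integral_congr_ae (Eventually.of_forall fun t => abs_of_pos (mul_pos hl (h0 _)))
      have h3 : |(∫ t in Ioi X, ρ t) * U ω| ≤ ∫ t in Ioi X, ρ t := by
        rw [abs_of_nonneg (mul_nonneg hR0.le (hU ω).1)]
        exact mul_le_of_le_one_right hR0.le (hU ω).2
      refine (abs_sub _ _).trans ?_
      linarith
    | succ k ih =>
      intro hk
      have hk' : ((k : ℝ) + 1) * h ≤ X := by
        rw [← hnh]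
        exact mul_le_mul_of_nonneg_right (by exact_mod_cast hk) hh.le
      set x := X - ((k + 1 : ℕ) : ℝ) * h with hx_def
      have hx : X - k * h = h + x := by rw [hx_def]; push_cast; ring
      have hx0 : 0 ≤ x := by rw [hx_def]; push_cast; linarith
      have hxX : h + x ≤ X := by
        have : 0 ≤ (k : ℝ) * h := by positivity
        linarith
      have e1 : ∀ a, ∫ t in Ioi a, ρ (t + x) = ∫ t in Ioi (a + x), ρ t := fun a => by
        rw [← integral_comp_add_right_Ioi_zero _ a, ← integral_comp_add_right_Ioi_zero ρ]
        simp only [add_assoc]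
      have hnear := ih (by omega)
      rw [hx] at hnear
      have hmono : ∫ t in Ioi X, ρ t ≤ ∫ t in Ioi (h + x), ρ t :=
        setIntegral_mono_set (hi.mono_set (Ioi_subset_Ioi (by linarith)))
          (Eventually.of_forall fun t => (h0 t).le) (Ioi_subset_Ioi hxX).eventuallyLE
      have hstep' := eventually_abs_densityValue_sub_le_of_shift hg hmeas ζ hdp hU hstep
        (ρ := fun t => ρ (t + x)) (fun t _ => (h0 _).le) (IntegrableOn.comp_add_right_Ioi hi hx0)
        hh (h0 x) (δ := η / (8 * X)) (fun t ht => by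
          have := hunif (t + x) ⟨by linarith [ht.1], by linarith [ht.2]⟩ x ⟨hx0, by linarith⟩
            (by rw [Real.dist_eq, add_sub_cancel_right, abs_of_pos ht.1]; linarith [ht.2])
          exact (Real.dist_eq _ _ ▸ this).le)
        (by rw [e1]; linarith)
        (by
          rw [e1]
          have := hP x ⟨hx0, by linarith⟩
          have := mul_le_mul_of_nonneg_right this hh.le
          have := mul_le_mul_of_nonneg_left hmono hθ₀.le
          linarith)
        (by simpa only [e1, add_assoc] using hnear)
      filter_upwards [hstep'] with lam hl ω
      have h1 := hl ω
      rw [e1, zero_add] at h1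
      refine h1.trans ?_
      have h2 : η / (4 * X * P) * ρ x * h ≤ η / (4 * X) * h := by
        have h3 : η / (4 * X * P) * ρ x ≤ η / (4 * X * P) * P :=
          mul_le_mul_of_nonneg_left (hP x ⟨hx0, by linarith⟩) (by positivity)
        refine mul_le_mul_of_nonneg_right (h3.trans_eq ?_) hh.le
        field_simp
      have h4 : 2 * (η / (8 * X)) * h = η / (4 * X) * h := by field_simp; norm_num
      have h5 : η / (2 * X) * h = η / (4 * X) * h + η / (4 * X) * h := by field_simp; norm_num
      push_cast
      linarith
  filter_upwards [key n le_rfl] with lam hl ω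
  have h1 := hl ω
  simp only [hnh, sub_self, add_zero] at h1
  refine h1.trans_eq ?_
  rw [mul_left_comm, hnh]
  field_simp
  norm_num

/-- Asymptotic invariance determines the limit value of every rescaled density. -/
theorem AsymptoticallyInvariant.tendstoUniformly_scaleDensity
    (hg : ∀ ω, g ω ∈ Icc (0 : ℝ) 1)
    (hmeas : ∀ z ∈ K, AEMeasurable (fun t : ℝ => g (z t.toNNReal)) (volume.restrict (Ioi 0)))
    {ζ : ∀ ω, L ω → M ω → K}
    (hdp : ∀ T : ℝ≥0, 0 < T → ∀ ρ : ℝ → ℝ, IsDensity ρ →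
      ∀ ω, lowerValue ζ (dynamicPayoff g ζ ρ T) ω = densityValue g ζ ρ ω)
    {U : Ω → ℝ} (hU : ∀ ω, U ω ∈ Icc (0 : ℝ) 1) (hinv : AsymptoticallyInvariant g ζ U)
    {μ : ℝ → ℝ} (hμ : IsDensity μ) :
    TendstoUniformly (fun lam => densityValue g ζ (scaleDensity μ lam)) U (𝓝[>] 0) := by
  rw [Metric.tendstoUniformly_iff]
  intro ε hε
  obtain ⟨f, -, hf, hfc, hfi⟩ := (integrable_indicator_iff measurableSet_Ioi).2 hμ.2.1
    |>.exists_hasCompactSupport_integral_sub_le (show 0 < ε / 8 by positivity)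
  -- As `μ ≥ 0` on the half-line, `|f|` is no farther from `μ` than `f`; the exponential makes the
  -- weight strictly positive at `L¹` cost `ε / 8`.
  set ρ : ℝ → ℝ := fun t => |f t| + ε / 8 * Real.exp (-t) with hρ_def
  have hexp : IntegrableOn (fun t : ℝ => ε / 8 * Real.exp (-t)) (Ioi 0) :=
    (integrableOn_exp_neg_Ioi 0).const_mul _
  have hρi : IntegrableOn ρ (Ioi 0) := hfi.abs.integrableOn.add hexp
  have hρ0 : ∀ t, 0 < ρ t := fun t => by positivity
  have hρc : Continuous ρ := by fun_prop
  have hdist : ∫ t in Ioi 0, |μ t - ρ t| ≤ ε / 4 := by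
    have hμf : IntegrableOn (fun t => |μ t - f t|) (Ioi 0) := (hμ.2.1.sub hfi.integrableOn).abs
    have h1 : ∫ t in Ioi 0, |μ t - ρ t| ≤
        ∫ t in Ioi 0, (|μ t - f t| + ε / 8 * Real.exp (-t)) := by
      refine setIntegral_mono_on (hμ.2.1.sub hρi).abs (hμf.add hexp) measurableSet_Ioi
        fun t ht => ?_
      have h2 : |μ t - (|f t|)| ≤ |μ t - f t| := by
        have := abs_abs_sub_abs_le (μ t) (f t)
        rwa [abs_of_nonneg (hμ.1 t (le_of_lt ht))] at this
      have h3 : 0 < ε / 8 * Real.exp (-t) := by positivity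
      have h4 := abs_sub (μ t - (|f t|)) (ε / 8 * Real.exp (-t))
      rw [abs_of_pos h3, sub_sub] at h4
      linarith
    rw [integral_add hμf hexp, integral_const_mul, integral_exp_neg_Ioi_zero] at h1
    have h5 : ∫ t in Ioi 0, |μ t - f t| ≤ ε / 8 := by
      refine le_trans ?_ hf
      have h6 : ∫ t in Ioi 0, |μ t - f t| = ∫ t in Ioi 0, ‖(Ioi 0).indicator μ t - f t‖ :=
        setIntegral_congr_fun measurableSet_Ioi fun t ht => by
          simp only [indicator_of_mem ht, Real.norm_eq_abs]
      rw [h6]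
      exact setIntegral_le_integral
        (((integrable_indicator_iff measurableSet_Ioi).2 hμ.2.1).sub hfi).norm
        (Eventually.of_forall fun t => norm_nonneg _)
    linarith
  have hmass : |(∫ t in Ioi 0, ρ t) - 1| ≤ ε / 4 := by
    rw [← hμ.2.2, abs_sub_comm, ← integral_sub hμ.2.1 hρi]
    exact abs_integral_le_integral_abs.trans hdist
  filter_upwards [hinv.eventually_abs_densityValue_sub_le hg hmeas hdp hU hρc hρ0 hρi
    (show 0 < ε / 4 by positivity), self_mem_nhdsWithin] with lam h1 hl ω
  have hl : 0 < lam := hl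
  have h2 := abs_densityValue_sub_le hg hmeas ζ (IntegrableOn.scaleDensity hμ.2.1 hl)
    (IntegrableOn.scaleDensity hρi hl) ω
  rw [integral_scaleDensity_abs_sub μ ρ hl] at h2
  have h3 : |(∫ t in Ioi 0, ρ t) * U ω - U ω| ≤ ε / 4 := by
    rw [← sub_one_mul, abs_mul, abs_of_nonneg (hU ω).1]
    exact (mul_le_of_le_one_right (abs_nonneg _) (hU ω).2).trans hmass
  have h4 := abs_sub_le (densityValue g ζ (scaleDensity μ lam) ω)
    (densityValue g ζ (scaleDensity ρ lam) ω) (U ω)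
  have h5 := abs_sub_le (densityValue g ζ (scaleDensity ρ lam) ω) ((∫ t in Ioi 0, ρ t) * U ω) (U ω)
  rw [Real.dist_eq, abs_sub_comm]
  linarith [h1 ω]

end Convergence

/-! ### The self-similar densities -/

section Densities

theorem TendstoUniformly.of_eventuallyEq_comp {ι ι' α β : Type*} [UniformSpace β]
    {F : ι → α → β} {F' : ι' → α → β} {U : α → β} {p : Filter ι} {p' : Filter ι'} {φ : ι' → ι}
    (h : TendstoUniformly F U p) (hφ : Tendsto φ p' p) (he : ∀ᶠ i in p', F' i = F (φ i)) :
    TendstoUniformly F' U p' := by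
  intro u hu
  filter_upwards [hφ.eventually (h u hu), he] with i h1 h2
  rwa [h2]

theorem tendsto_mul_const_nhdsGT_zero {c : ℝ} (hc : 0 < c) :
    Tendsto (fun lam : ℝ => c * lam) (𝓝[>] 0) (𝓝[>] 0) := by
  refine tendsto_nhdsWithin_iff.2 ⟨?_, ?_⟩
  · have : Continuous fun lam : ℝ => c * lam := by fun_prop
    simpa using (this.tendsto 0).mono_left nhdsWithin_le_nhds
  · filter_upwards [self_mem_nhdsWithin] with lam hl using mul_pos hc hl

/-- The density `t ↦ (1 + t / k) ^ (-(k + 1))`. -/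
noncomputable def standardPowerDensity (k : ℝ) : ℝ → ℝ :=
  fun t => (1 + t / k) ^ (-(k + 1))

theorem isDensity_standardPowerDensity {k : ℝ} (hk : 0 < k) :
    IsDensity (standardPowerDensity k) := by
  have hpos : ∀ t : ℝ, 0 ≤ t → 0 < 1 + t / k := fun t ht => by positivity
  -- This antiderivative rises from `-1` at `0` to `0` at infinity, giving both integrability and
  -- mass `1`.
  have hderiv : ∀ t ∈ Ici (0 : ℝ), HasDerivAt (fun t : ℝ => -(1 + t / k) ^ (-k))
      (standardPowerDensity k t) t := fun t ht => by
    have h1 : HasDerivAt (fun t : ℝ => 1 + t / k) (1 / k) t :=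
      ((hasDerivAt_id t).div_const k).const_add 1
    refine (h1.rpow_const (p := -k) (Or.inl (hpos t ht).ne')).neg.congr_deriv ?_
    rw [show -k - 1 = -(k + 1) by ring]
    simp only [standardPowerDensity]
    field_simp
  have hnonneg : ∀ t, 0 ≤ t → 0 ≤ standardPowerDensity k t := fun t ht =>
    Real.rpow_nonneg (hpos t ht).le _
  have hlim : Tendsto (fun t : ℝ => -(1 + t / k) ^ (-k)) atTop (𝓝 0) := by
    have h1 : Tendsto (fun t : ℝ => 1 + t / k) atTop atTop :=
      tendsto_atTop_add_const_left _ _ (tendsto_id.atTop_div_const hk)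
    simpa using ((tendsto_rpow_neg_atTop hk).comp h1).neg
  refine ⟨hnonneg, integrableOn_Ioi_deriv_of_nonneg' hderiv
    (fun t ht => hnonneg t (le_of_lt ht)) hlim, ?_⟩
  rw [integral_Ioi_of_hasDerivAt_of_nonneg' hderiv (fun t ht => hnonneg t (le_of_lt ht)) hlim]
  simp

theorem tendsto_standardPowerDensity_nhdsGT_zero (k : ℝ) :
    Tendsto (standardPowerDensity k) (𝓝[>] 0) (𝓝 1) := by
  have : ContinuousAt (standardPowerDensity k) 0 := by
    refine ContinuousAt.rpow_const (by fun_prop) (Or.inl (by simp))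
  have h1 := this.tendsto.mono_left (nhdsWithin_le_nhds (s := Ioi 0))
  simpa [standardPowerDensity] using h1

/-- Factor `1 + h / k` out of the affine base. The exponent is `-k`, not `-(k + 1)`, because
`scaleDensity` already supplies one factor `(1 + h / k)⁻¹`. -/
theorem standardPowerDensity_add {k h t : ℝ} (hk : 0 < k) (hh : 0 ≤ h) (ht : 0 ≤ t) :
    standardPowerDensity k (t + h) =
      (1 + h / k) ^ (-k) * scaleDensity (standardPowerDensity k) (1 + h / k)⁻¹ t := by
  have h1 : 0 < 1 + h / k := by positivity
  have h2 : 1 + (t + h) / k = (1 + h / k) * (1 + (1 + h / k)⁻¹ * t / k) := by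
    field_simp
    ring
  rw [standardPowerDensity, h2, Real.mul_rpow h1.le (by positivity), scaleDensity,
    standardPowerDensity, ← mul_assoc, ← Real.rpow_neg_one, ← Real.rpow_add h1]
  congr 2
  ring

theorem isPowerDensity_standardPowerDensity {k : ℝ} (hk : 0 < k) :
    IsPowerDensity (standardPowerDensity k) := by
  refine ⟨isDensity_standardPowerDensity hk, 1, 1 / k, k + 1, one_pos, by positivity,
    by positivity, fun t ht => ?_⟩
  rw [standardPowerDensity, Real.rpow_neg (by positivity), one_div, one_div, div_eq_inv_mul]

/-- Normalized shifts of a power density are rescalings of a standard one. -/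
theorem IsPowerDensity.exists_shiftDensity_eq {ρ : ℝ → ℝ} (hρ : IsPowerDensity ρ) :
    ∃ k a b : ℝ, 0 < k ∧ 0 < a ∧ 0 < b ∧ ∀ T, 0 ≤ T → ∀ t, 0 < t →
      shiftDensity ρ T t = scaleDensity (standardPowerDensity k) (k / (a + b * T)) t := by
  obtain ⟨⟨-, hi, -⟩, α, β, γ, hα, hβ, -, hform⟩ := hρ
  -- Integrability at infinity forces this, so that `k = γ - 1` is positive.
  have hγ : 1 < γ := by
    have h1 : IntegrableOn (fun t : ℝ => (β * t + α) ^ (-γ)) (Ioi 0) := by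
      refine hi.congr_fun (fun t ht => ?_) measurableSet_Ioi
      have ht : 0 < t := ht
      rw [hform t ht.le, Real.rpow_neg (by positivity), one_div, add_comm]
    rw [integrableOn_Ioi_comp_mul_left_iff (fun x : ℝ => (x + α) ^ (-γ)) 0 hβ, mul_zero,
      integrableOn_comp_add_right_Ioi_zero_iff (ρ := fun x : ℝ => x ^ (-γ)),
      integrableOn_Ioi_rpow_iff hα] at h1
    linarith
  have hk : 0 < γ - 1 := by linarith
  refine ⟨γ - 1, α / β, 1, hk, by positivity, one_pos, fun T hT t ht => ?_⟩
  set φ := (γ - 1) / (α / β + 1 * T) with hφ_def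
  have hφ : 0 < φ := by positivity
  have hc : 0 < α + β * T := by positivity
  have key : ∀ s, 0 ≤ s → ρ (s + T) =
      (α + β * T) ^ (-γ) / φ * scaleDensity (standardPowerDensity (γ - 1)) φ s := fun s hs => by
    have h2 : α + β * (s + T) = (α + β * T) * (1 + φ * s / (γ - 1)) := by
      rw [hφ_def]
      field_simp
      ring
    rw [hform _ (by positivity), h2, one_div, ← Real.rpow_neg (by positivity),
      Real.mul_rpow hc.le (by positivity), scaleDensity, standardPowerDensity]
    rw [show -(γ - 1 + 1) = -γ by ring]
    field_simp
  -- The prefactor in `key` is the tail mass, because a rescaled density has mass `1`; normalization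
  -- removes it.
  have hmass : ∫ s in Ioi T, ρ s = (α + β * T) ^ (-γ) / φ := by
    rw [← integral_comp_add_right_Ioi_zero, setIntegral_congr_fun measurableSet_Ioi
      (fun s hs => key s (le_of_lt hs)), integral_const_mul, integral_scaleDensity _ hφ,
      (isDensity_standardPowerDensity hk).2.2, mul_one]
  have hne : (α + β * T) ^ (-γ) / φ ≠ 0 := (div_pos (Real.rpow_pos_of_pos hc _) hφ).ne'
  rw [shiftDensity, hmass, key t ht.le, mul_div_cancel_left₀ _ hne]

theorem isDensity_expDensity_one : IsDensity (expDensity 1) := by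
  refine ⟨fun t _ => ?_, ?_, ?_⟩
  · simp only [expDensity]
    positivity
  · exact (integrableOn_exp_neg_Ioi 0).congr_fun (fun t _ => by simp [expDensity])
      measurableSet_Ioi
  · simpa [expDensity] using integral_exp_neg_Ioi_zero

theorem piecewiseContinuousOnPos_expDensity_one : PiecewiseContinuousOnPos (expDensity 1) := by
  have hc : Continuous (expDensity 1) := by
    unfold expDensity
    fun_prop
  refine ⟨fun t _ => ⟨⟨_, (hc.tendsto t).mono_left nhdsWithin_le_nhds⟩,
    ⟨_, (hc.tendsto t).mono_left nhdsWithin_le_nhds⟩⟩, fun a b _ => ?_⟩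
  simp [hc.continuousAt]

theorem scaleDensity_expDensity_one (lam : ℝ) : scaleDensity (expDensity 1) lam = expDensity lam := by
  funext t
  simp [scaleDensity, expDensity]

theorem isDensity_uniformDensity_one : IsDensity (uniformDensity 1) := by
  refine ⟨fun t _ => indicator_nonneg (by simp) t, ?_, ?_⟩
  · exact ((integrable_indicator_iff measurableSet_Icc).2
      (integrableOn_const (by simp))).integrableOn
  · rw [uniformDensity, setIntegral_indicator measurableSet_Icc,
      show Ioi (0 : ℝ) ∩ Icc 0 1 = Ioc 0 1 by ext; simp; grind]
    simp

theorem scaleDensity_uniformDensity_one {T t : ℝ} (hT : 0 < T) (ht : 0 < t) :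
    scaleDensity (uniformDensity 1) T⁻¹ t = uniformDensity T t := by
  have h1 : T⁻¹ * t ∈ Icc (0 : ℝ) 1 ↔ t ∈ Icc 0 T := by
    have : 0 < T⁻¹ * t := by positivity
    simp [this.le, ht.le, inv_mul_le_iff₀ hT]
  by_cases h : t ∈ Icc 0 T
  · simp [scaleDensity, uniformDensity, h, h1.2 h, -mem_Icc]
  · simp [scaleDensity, uniformDensity, h, mt h1.1 h, -mem_Icc]

end Densities

/-! ### Tauberian theorems for the three families -/

section Tauberian

variable {Ω : Type*} {K : Set (ℝ≥0 → Ω)} {L M : Ω → Type*} {g : Ω → ℝ}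

theorem tendstoUniformly_expDensity_iff {ζ : ∀ ω, L ω → M ω → K} {U : Ω → ℝ} :
    TendstoUniformly (fun lam => densityValue g ζ (expDensity lam)) U (𝓝[>] 0) ↔
      TendstoUniformly (fun lam => densityValue g ζ (scaleDensity (expDensity 1) lam)) U
        (𝓝[>] 0) := by
  simp only [scaleDensity_expDensity_one]

theorem tendstoUniformly_uniformDensity_iff {ζ : ∀ ω, L ω → M ω → K} {U : Ω → ℝ} :
    TendstoUniformly (fun T => densityValue g ζ (uniformDensity T)) U atTop ↔
      TendstoUniformly (fun lam => densityValue g ζ (scaleDensity (uniformDensity 1) lam)) U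
        (𝓝[>] 0) := by
  refine ⟨fun h => h.of_eventuallyEq_comp tendsto_inv_nhdsGT_zero ?_,
    fun h => h.of_eventuallyEq_comp tendsto_inv_atTop_nhdsGT_zero ?_⟩
  · filter_upwards [self_mem_nhdsWithin] with lam hl
    refine densityValue_congr g ζ fun t ht => ?_
    rw [← scaleDensity_uniformDensity_one (inv_pos.2 hl) ht, inv_inv]
  · filter_upwards [eventually_gt_atTop 0] with T hT
    exact densityValue_congr g ζ fun t ht => (scaleDensity_uniformDensity_one hT ht).symm

/-- The change of parameter is `lam = k / (a + b * T)`, with inverse `T = k / (b * lam) - a / b`; it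
exchanges `T → ∞` and `lam → 0+`. -/
theorem IsPowerDensity.exists_tendstoUniformly_shiftDensity_iff {ρ : ℝ → ℝ}
    (hρ : IsPowerDensity ρ) : ∃ k, 0 < k ∧ ∀ (ζ : ∀ ω, L ω → M ω → K) (U : Ω → ℝ),
    (TendstoUniformly (fun T => densityValue g ζ (shiftDensity ρ T)) U atTop ↔
      TendstoUniformly (fun lam => densityValue g ζ (scaleDensity (standardPowerDensity k) lam)) U
        (𝓝[>] 0)) := by
  obtain ⟨k, a, b, hk, ha, hb, hshift⟩ := hρ.exists_shiftDensity_eq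
  refine ⟨k, hk, fun ζ U => ⟨fun h => ?_, fun h => ?_⟩⟩
  · have hφ : Tendsto (fun lam : ℝ => k / b * lam⁻¹ + -(a / b)) (𝓝[>] 0) atTop :=
      tendsto_atTop_add_const_right _ _
        (tendsto_inv_nhdsGT_zero.const_mul_atTop (by positivity))
    refine h.of_eventuallyEq_comp hφ ?_
    filter_upwards [hφ.eventually_ge_atTop 0, self_mem_nhdsWithin] with lam h0 hl
    have hl : 0 < lam := hl
    refine densityValue_congr g ζ fun t ht => ?_
    have h1 : a + b * (k / b * lam⁻¹ + -(a / b)) = k / lam := by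
      field_simp
      ring
    rw [hshift _ h0 t ht, h1, div_div_cancel₀ hk.ne']
  · have hφ : Tendsto (fun T : ℝ => k / (a + b * T)) atTop (𝓝[>] 0) := by
      refine tendsto_nhdsWithin_iff.2 ⟨tendsto_const_nhds.div_atTop
        (tendsto_atTop_add_const_left _ _ (tendsto_id.const_mul_atTop hb)), ?_⟩
      filter_upwards [eventually_ge_atTop 0] with T hT
      exact div_pos hk (by positivity)
    refine h.of_eventuallyEq_comp hφ ?_
    filter_upwards [eventually_ge_atTop 0] with T hT
    exact densityValue_congr g ζ fun t ht => hshift T hT t ht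

variable [∀ ω, Nonempty (L ω)] [∀ ω, Nonempty (M ω)]

/-- Values for densities lie in `[0, 1]`, and this closed condition passes to the limit. It serves
the existence statement, where no range of the limit is given. -/
theorem mem_Icc_of_tendstoUniformly_scaleDensity (hg : ∀ ω, g ω ∈ Icc (0 : ℝ) 1)
    (hmeas : ∀ z ∈ K, AEMeasurable (fun t : ℝ => g (z t.toNNReal)) (volume.restrict (Ioi 0)))
    {ζ : ∀ ω, L ω → M ω → K} {U : Ω → ℝ} {ρ : ℝ → ℝ} (hρ : IsDensity ρ)
    (hlim : TendstoUniformly (fun lam => densityValue g ζ (scaleDensity ρ lam)) U (𝓝[>] 0))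
    (ω : Ω) : U ω ∈ Icc (0 : ℝ) 1 := by
  refine isClosed_Icc.mem_of_tendsto (hlim.tendsto_at ω) ?_
  filter_upwards [self_mem_nhdsWithin] with lam hl
  have hl : 0 < lam := hl
  have h0 : ∀ t, 0 ≤ t → 0 ≤ scaleDensity ρ lam t := fun t ht =>
    mul_nonneg hl.le (hρ.1 _ (mul_nonneg hl.le ht))
  refine ⟨densityValue_nonneg hg ζ h0 ω, (le_abs_self _).trans
    ((abs_densityValue_le hg hmeas ζ (IntegrableOn.scaleDensity hρ.2.1 hl) ω).trans_eq ?_)⟩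
  rw [setIntegral_congr_fun measurableSet_Ioi fun t ht => abs_of_nonneg (h0 t (le_of_lt ht)),
    integral_scaleDensity ρ hl, hρ.2.2]

/-- If the values of the rescalings of a density whose small shifts are proportional to its
rescalings converge, then those of all densities converge to the same limit. -/
theorem tendstoUniformly_scaleDensity_of_selfSimilar (hg : ∀ ω, g ω ∈ Icc (0 : ℝ) 1)
    (hmeas : ∀ z ∈ K, AEMeasurable (fun t : ℝ => g (z t.toNNReal)) (volume.restrict (Ioi 0)))
    {ζ : ∀ ω, L ω → M ω → K}
    (hdp : ∀ T : ℝ≥0, 0 < T → ∀ ρ : ℝ → ℝ, IsDensity ρ →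
      ∀ ω, lowerValue ζ (dynamicPayoff g ζ ρ T) ω = densityValue g ζ ρ ω)
    {U : Ω → ℝ} {ρ : ℝ → ℝ} (hρ : IsDensity ρ) (hone : Tendsto ρ (𝓝[>] 0) (𝓝 1))
    (hself : ∀ h, 0 < h → h < 1 → ∃ a c : ℝ, 0 ≤ a ∧ 0 < c ∧
      ∀ t, 0 < t → ρ (t + h) = a * scaleDensity ρ c t)
    (hlim : TendstoUniformly (fun lam => densityValue g ζ (scaleDensity ρ lam)) U (𝓝[>] 0))
    {μ : ℝ → ℝ} (hμ : IsDensity μ) :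
    TendstoUniformly (fun lam => densityValue g ζ (scaleDensity μ lam)) U (𝓝[>] 0) := by
  have hU := mem_Icc_of_tendstoUniformly_scaleDensity hg hmeas hρ hlim
  refine AsymptoticallyInvariant.tendstoUniformly_scaleDensity hg hmeas hdp hU
    (asymptoticallyInvariant_of_tendsto_shift hg hmeas ζ hdp hU hρ hone one_pos hlim
      fun h h0 h1 => ?_) hμ
  obtain ⟨a, c, ha, hc, hac⟩ := hself h h0 h1
  -- Integrating the self-similarity identity identifies `a`; the shifted values are then `a` times
  -- the unshifted ones at `c * lam`.
  have hmass : ∫ t in Ioi h, ρ t = a := by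
    rw [← integral_comp_add_right_Ioi_zero, setIntegral_congr_fun measurableSet_Ioi hac,
      integral_const_mul, integral_scaleDensity ρ hc, hρ.2.2, mul_one]
  rw [hmass]
  refine TendstoUniformly.of_eventuallyEq_comp (φ := fun lam => c * lam)
    ((Real.uniformContinuous_const_mul (x := a)).comp_tendstoUniformly hlim)
    (tendsto_mul_const_nhdsGT_zero hc) ?_
  filter_upwards [self_mem_nhdsWithin] with lam hl
  funext ω
  have hl : 0 < lam := hl
  simp only [Function.comp_apply]
  rw [← densityValue_const_mul g ζ _ ha]
  refine congrFun (densityValue_congr g ζ fun t ht => ?_) ω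
  simp only [scaleDensity] at hac ⊢
  rw [hac _ (mul_pos hl ht)]
  simp only [mul_assoc, mul_left_comm]

theorem tendstoUniformly_scaleDensity_of_uniformDensity (hg : ∀ ω, g ω ∈ Icc (0 : ℝ) 1)
    (hmeas : ∀ z ∈ K, AEMeasurable (fun t : ℝ => g (z t.toNNReal)) (volume.restrict (Ioi 0)))
    {ζ : ∀ ω, L ω → M ω → K}
    (hdp : ∀ T : ℝ≥0, 0 < T → ∀ ρ : ℝ → ℝ, IsDensity ρ →
      ∀ ω, lowerValue ζ (dynamicPayoff g ζ ρ T) ω = densityValue g ζ ρ ω) {U : Ω → ℝ}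
    (hlim : TendstoUniformly (fun T => densityValue g ζ (uniformDensity T)) U atTop)
    {μ : ℝ → ℝ} (hμ : IsDensity μ) :
    TendstoUniformly (fun lam => densityValue g ζ (scaleDensity μ lam)) U (𝓝[>] 0) := by
  refine tendstoUniformly_scaleDensity_of_selfSimilar hg hmeas hdp isDensity_uniformDensity_one
    ?_ (fun h h0 h1 => ?_) (tendstoUniformly_uniformDensity_iff.1 hlim) hμ
  · refine tendsto_const_nhds.congr' ?_
    filter_upwards [Ioo_mem_nhdsGT (zero_lt_one' ℝ)] with t ht
    simp [uniformDensity, ht.1.le, ht.2.le]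
  -- The uniform law on `[0, 1]` shifted by `h` is `1 - h` times the uniform law on `[0, 1 - h]`.
  · refine ⟨1 - h, (1 - h)⁻¹, by linarith, inv_pos.2 (by linarith), fun t ht => ?_⟩
    have hh : 0 < 1 - h := by linarith
    rw [scaleDensity_uniformDensity_one hh ht]
    have h2 : t + h ∈ Icc 0 1 ↔ t ∈ Icc 0 (1 - h) := by
      simp only [mem_Icc]
      constructor <;> rintro ⟨_, _⟩ <;> constructor <;> linarith
    by_cases h3 : t ∈ Icc 0 (1 - h)
    · simp [uniformDensity, h3, h2.2 h3, -mem_Icc, hh.ne']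
    · simp [uniformDensity, h3, mt h2.1 h3, -mem_Icc]

theorem tendstoUniformly_scaleDensity_of_expDensity (hg : ∀ ω, g ω ∈ Icc (0 : ℝ) 1)
    (hmeas : ∀ z ∈ K, AEMeasurable (fun t : ℝ => g (z t.toNNReal)) (volume.restrict (Ioi 0)))
    {ζ : ∀ ω, L ω → M ω → K}
    (hdp : ∀ T : ℝ≥0, 0 < T → ∀ ρ : ℝ → ℝ, IsDensity ρ →
      ∀ ω, lowerValue ζ (dynamicPayoff g ζ ρ T) ω = densityValue g ζ ρ ω) {U : Ω → ℝ}
    (hlim : TendstoUniformly (fun lam => densityValue g ζ (expDensity lam)) U (𝓝[>] 0))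
    {μ : ℝ → ℝ} (hμ : IsDensity μ) :
    TendstoUniformly (fun lam => densityValue g ζ (scaleDensity μ lam)) U (𝓝[>] 0) := by
  refine tendstoUniformly_scaleDensity_of_selfSimilar hg hmeas hdp isDensity_expDensity_one
    ?_ (fun h h0 h1 => ?_) (tendstoUniformly_expDensity_iff.1 hlim) hμ
  · have hc : Continuous (expDensity 1) := by
      unfold expDensity
      fun_prop
    simpa [expDensity] using (hc.tendsto 0).mono_left (nhdsWithin_le_nhds (s := Ioi 0))
  -- Memorylessness: the shift needs no rescaling, so `c = 1`.
  · refine ⟨Real.exp (-h), 1, (Real.exp_pos _).le, one_pos, fun t ht => ?_⟩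
    simp [expDensity, scaleDensity, Real.exp_add]

theorem IsPowerDensity.tendstoUniformly_scaleDensity (hg : ∀ ω, g ω ∈ Icc (0 : ℝ) 1)
    (hmeas : ∀ z ∈ K, AEMeasurable (fun t : ℝ => g (z t.toNNReal)) (volume.restrict (Ioi 0)))
    {ζ : ∀ ω, L ω → M ω → K}
    (hdp : ∀ T : ℝ≥0, 0 < T → ∀ ρ : ℝ → ℝ, IsDensity ρ →
      ∀ ω, lowerValue ζ (dynamicPayoff g ζ ρ T) ω = densityValue g ζ ρ ω) {U : Ω → ℝ}
    {ρ : ℝ → ℝ} (hρ : IsPowerDensity ρ)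
    (hlim : TendstoUniformly (fun T => densityValue g ζ (shiftDensity ρ T)) U atTop)
    {μ : ℝ → ℝ} (hμ : IsDensity μ) :
    TendstoUniformly (fun lam => densityValue g ζ (scaleDensity μ lam)) U (𝓝[>] 0) := by
  obtain ⟨k, hk, hiff⟩ := hρ.exists_tendstoUniformly_shiftDensity_iff (K := K) (L := L) (M := M)
    (g := g)
  exact tendstoUniformly_scaleDensity_of_selfSimilar hg hmeas hdp
    (isDensity_standardPowerDensity hk) (tendsto_standardPowerDensity_nhdsGT_zero k)
    (fun h h0 _ => ⟨(1 + h / k) ^ (-k), (1 + h / k)⁻¹, by positivity, by positivity,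
      fun t ht => standardPowerDensity_add hk h0.le ht.le⟩) ((hiff ζ U).1 hlim) hμ

end Tauberian

theorem mainTheorem4 {Ω : Type*} [Nonempty Ω] (K : Set (ℝ≥0 → Ω)) (g : Ω → ℝ)
    (hg : ∀ ω, g ω ∈ Icc (0 : ℝ) 1)
    (hmeas : ∀ z ∈ K, AEMeasurable (fun t : ℝ => g (z t.toNNReal)) (volume.restrict (Ioi 0)))
    (L M : Ω → Type*) [∀ ω, Nonempty (L ω)] [∀ ω, Nonempty (M ω)]
    (ζ : ∀ ω, L ω → M ω → K)
    (hdp : ∀ T : ℝ≥0, 0 < T → ∀ ρ : ℝ → ℝ, IsDensity ρ →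
      ∀ ω, lowerValue ζ (dynamicPayoff g ζ ρ T) ω = densityValue g ζ ρ ω) :
    (∀ U : Ω → ℝ, (∀ ω, U ω ∈ Icc (0 : ℝ) 1) →
      List.TFAE [
        ∀ μ : ℝ → ℝ, IsDensity μ → PiecewiseContinuousOnPos μ →
          TendstoUniformly (fun lam => densityValue g ζ (scaleDensity μ lam)) U (𝓝[>] 0),
        TendstoUniformly (fun T => densityValue g ζ (uniformDensity T)) U atTop,
        TendstoUniformly (fun lam => densityValue g ζ (expDensity lam)) U (𝓝[>] 0),
        ∃ ρ : ℝ → ℝ, IsPowerDensity ρ ∧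
          TendstoUniformly (fun T => densityValue g ζ (shiftDensity ρ T)) U atTop,
        ∀ ρ : ℝ → ℝ, IsPowerDensity ρ →
          TendstoUniformly (fun T => densityValue g ζ (shiftDensity ρ T)) U atTop]) ∧
    (((∃ U : Ω → ℝ, TendstoUniformly (fun T => densityValue g ζ (uniformDensity T)) U atTop) ∨
      (∃ U : Ω → ℝ,
        TendstoUniformly (fun lam => densityValue g ζ (expDensity lam)) U (𝓝[>] 0)) ∨
      (∃ ρ : ℝ → ℝ, IsPowerDensity ρ ∧ ∃ U : Ω → ℝ,
        TendstoUniformly (fun T => densityValue g ζ (shiftDensity ρ T)) U atTop)) →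
      ∃ U : Ω → ℝ,
        TendstoUniformly (fun T => densityValue g ζ (uniformDensity T)) U atTop ∧
        TendstoUniformly (fun lam => densityValue g ζ (expDensity lam)) U (𝓝[>] 0) ∧
        (∀ ρ : ℝ → ℝ, IsPowerDensity ρ →
          TendstoUniformly (fun T => densityValue g ζ (shiftDensity ρ T)) U atTop) ∧
        ∀ μ : ℝ → ℝ, IsDensity μ → PiecewiseContinuousOnPos μ →
          TendstoUniformly (fun lam => densityValue g ζ (scaleDensity μ lam)) U (𝓝[>] 0)) := by
  -- Each family is, up to a change of parameter, the rescalings of a single density.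
  have of_all : ∀ U : Ω → ℝ, (∀ μ : ℝ → ℝ, IsDensity μ →
      TendstoUniformly (fun lam => densityValue g ζ (scaleDensity μ lam)) U (𝓝[>] 0)) →
      TendstoUniformly (fun T => densityValue g ζ (uniformDensity T)) U atTop ∧
      TendstoUniformly (fun lam => densityValue g ζ (expDensity lam)) U (𝓝[>] 0) ∧
      (∀ ρ : ℝ → ℝ, IsPowerDensity ρ →
        TendstoUniformly (fun T => densityValue g ζ (shiftDensity ρ T)) U atTop) ∧
      ∀ μ : ℝ → ℝ, IsDensity μ → PiecewiseContinuousOnPos μ →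
        TendstoUniformly (fun lam => densityValue g ζ (scaleDensity μ lam)) U (𝓝[>] 0) := by
    intro U h
    refine ⟨tendstoUniformly_uniformDensity_iff.2 (h _ isDensity_uniformDensity_one),
      tendstoUniformly_expDensity_iff.2 (h _ isDensity_expDensity_one), fun ρ hρ => ?_,
      fun μ hμ _ => h μ hμ⟩
    obtain ⟨k, hk, hiff⟩ := hρ.exists_tendstoUniformly_shiftDensity_iff (K := K) (L := L) (M := M)
      (g := g)
    exact (hiff ζ U).2 (h _ (isDensity_standardPowerDensity hk))
  refine ⟨fun U _ => ?_, ?_⟩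
  · tfae_have 1 → 3 := fun h => tendstoUniformly_expDensity_iff.2
      (h _ isDensity_expDensity_one piecewiseContinuousOnPos_expDensity_one)
    tfae_have 3 → 2 := fun h => (of_all U fun _ hμ =>
      tendstoUniformly_scaleDensity_of_expDensity hg hmeas hdp h hμ).1
    tfae_have 2 → 5 := fun h => (of_all U fun _ hμ =>
      tendstoUniformly_scaleDensity_of_uniformDensity hg hmeas hdp h hμ).2.2.1
    tfae_have 5 → 4 := fun h => ⟨_, isPowerDensity_standardPowerDensity one_pos,
      h _ (isPowerDensity_standardPowerDensity one_pos)⟩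
    tfae_have 4 → 1 := fun ⟨_, hρ, h⟩ μ hμ _ =>
      hρ.tendstoUniformly_scaleDensity hg hmeas hdp h hμ
    tfae_finish
  · rintro (⟨U, h⟩ | ⟨U, h⟩ | ⟨ρ, hρ, U, h⟩)
    · exact ⟨U, of_all U fun _ hμ =>
        tendstoUniformly_scaleDensity_of_uniformDensity hg hmeas hdp h hμ⟩
    · exact ⟨U, of_all U fun _ hμ =>
        tendstoUniformly_scaleDensity_of_expDensity hg hmeas hdp h hμ⟩
    · exact ⟨U, of_all U fun _ hμ => hρ.tendstoUniformly_scaleDensity hg hmeas hdp h hμ⟩
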